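/- Let $k\ge 2$ and $d\ge 1$ be integers, and let $a:\mathbb N\to\mathcal A$, $\mathbb N=\{0,1,2,\dots\}$, be a synchronizing $k$-automatic sequence; that is, $a$ is generated by a finite automaton with output that reads the base-$k$ expansion of $n$ starting with the most significant digit and outputs $a(n)$, and the minimal automaton generating $a$ has a synchronizing word, i.e. a word $w\in\{0,\dots,k-1\}^*$ such that reading $w$ leads to one and the same state from every starting state. Define \[ \mathcal P_d=\{P\in\mathbb Z[X]:\ \deg P\le d,\ P(\mathbb N)\subseteq\mathbb N\}. \] Suppose that $a$ is uniformly deterministic along $\mathcal P_d$, that is, \[ \lim_{H\to\infty}\frac1H\log\#\bigl\{(a(P(n+\ell)))_{0\le\ell<H}:\ n\ge 0,\ P\in\mathcal P_d\bigr\}=0 . \] Then for every real $c\in(0,d+1)$ the sequence $b(n)=a(\lfloor n^c\rfloor)$, $n\ge0$, is deterministic, that is, \[ \lim_{H\to\infty}\frac1H\log\#\bigl\{(b(n),b(n+1),\dots,b(n+H-1)):\ n\ge 0\bigr\}=0 . \] -/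

import Mathlib

open Filter Topology Polynomial

/-- A deterministic finite automaton with output: states `σ`, input alphabet `{0, …, k - 1}`,
output alphabet `A`. (Finiteness of `σ` is imposed where the automaton is used.) -/
structure DFAO (k : ℕ) (A : Type*) (σ : Type) where
  /-- the edge labelled `j` leaving the state `s` leads to `step s j` -/
  step : σ → Fin k → σ
  /-- the initial state -/
  start : σ
  /-- the output attached to a state -/
  out : σ → A

/-- The base-`k` digital expansion of `n`, most significant digit first
(no leading zeros; the expansion of `0` is the empty word). -/
def baseExpansion {k : ℕ} (hk : 2 ≤ k) (n : ℕ) : List (Fin k) :=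
  (Nat.digits k n).reverse.pmap (fun j hj => (⟨j, hj⟩ : Fin k))
    (fun _ hj => Nat.digits_lt_base hk (List.mem_reverse.1 hj))

namespace DFAO

variable {k : ℕ} {A : Type*} {σ : Type}

/-- The state reached from `s` after reading the word `w` from left to right. -/
def run (M : DFAO k A σ) (s : σ) (w : List (Fin k)) : σ :=
  w.foldl M.step s

/-- `M` generates `a`: on input the base-`k` expansion of `n`, the output is `a n`. -/
def Generates (M : DFAO k A σ) (hk : 2 ≤ k) (a : ℕ → A) : Prop :=
  ∀ n : ℕ, M.out (M.run M.start (baseExpansion hk n)) = a n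

/-- `M` is a minimal automaton generating `a`: it is finite, generates `a`, and no finite automaton
that generates `a` has fewer states. -/
def IsMinimalFor (M : DFAO k A σ) (hk : 2 ≤ k) (a : ℕ → A) : Prop :=
  Finite σ ∧ M.Generates hk a ∧
    ∀ (τ : Type) (N : DFAO k A τ), Finite τ → N.Generates hk a → Nat.card σ ≤ Nat.card τ

/-- `w` is a synchronizing word for `M`: reading `w` leads to one and the same state, from
whichever state one starts. -/
def IsSynchronizingWord (M : DFAO k A σ) (w : List (Fin k)) : Prop :=
  ∃ s : σ, ∀ t : σ, M.run t w = s

end DFAO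

/-- `a` is a synchronizing `k`-automatic sequence: it is generated by a finite automaton reading
base-`k` expansions, and its minimal automaton has a synchronizing word. -/
def IsSynchronizingAutomatic {A : Type*} (k : ℕ) (hk : 2 ≤ k) (a : ℕ → A) : Prop :=
  ∃ (σ : Type) (M : DFAO k A σ), M.IsMinimalFor hk a ∧ ∃ w : List (Fin k), M.IsSynchronizingWord w

/-- A family `S H` of sets of words of length `H` is finite for each `H` and grows subexponentially:
`lim_{H → ∞} (1 / H) * log #(S H) = 0`. -/
def SubexponentialGrowth {A : Type*} (S : (H : ℕ) → Set (Fin H → A)) : Prop :=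
  (∀ H : ℕ, (S H).Finite) ∧
    Tendsto (fun H : ℕ => (1 / (H : ℝ)) * Real.log ((S H).ncard : ℝ)) atTop (𝓝 0)

/-- The set of words `(a n, a (n + 1), …, a (n + H - 1))`, `n ≥ 0`. -/
def subwords {A : Type*} (a : ℕ → A) (H : ℕ) : Set (Fin H → A) :=
  {w | ∃ n : ℕ, w = fun l : Fin H => a (n + (l : ℕ))}

/-- A deterministic sequence: its subword complexity is finite and subexponential. -/
def IsDeterministic {A : Type*} (a : ℕ → A) : Prop :=
  SubexponentialGrowth (subwords a)

/-- Integer polynomials of degree at most `d` (the zero polynomial included) that map `ℕ` to `ℕ`. -/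
def natValuedPolynomials (d : ℕ) : Set ℤ[X] :=
  {P | P.degree ≤ (d : WithBot ℕ) ∧ ∀ n : ℕ, 0 ≤ P.eval (n : ℤ)}

/-- The set of words `(a (P (n + l)))_{0 ≤ l < H}`, `n ≥ 0`, `P ∈ natValuedPolynomials d`.
The values of `P` are nonnegative here, so `Int.toNat` only changes their type. -/
def subwordsAlongPolynomials {A : Type*} (a : ℕ → A) (d H : ℕ) : Set (Fin H → A) :=
  {w | ∃ n : ℕ, ∃ P ∈ natValuedPolynomials d,
    w = fun l : Fin H => a (P.eval ((n + (l : ℕ) : ℕ) : ℤ)).toNat}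

/-- `a` is uniformly deterministic along the integer polynomials of degree at most `d`
mapping `ℕ` to `ℕ`. -/
def IsUniformlyDeterministic {A : Type*} (a : ℕ → A) (d : ℕ) : Prop :=
  SubexponentialGrowth (subwordsAlongPolynomials a d)

/-! Put D = ⌊c⌋. For large n, Taylor's formula makes m ↦ (n + m)^c uniformly close, on a window of
fixed length M, to a real polynomial of degree D with nonnegative coefficients
(`eventually_nearPolynomial_rpow`). The task is to count the words that the floors of such functions
produce.

The real coefficients are removed one degree at a time. If α is the leading coefficient of the real
part, in degree j ≥ 1, some q bounded independently of α makes q^j α nearly an integer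
(`exists_bound_pow_mul_near_int`, by van der Waerden and compactness). Along progressions with
difference q the leading term then joins the integer part, up to a small error. A long window is a
union of such progressions, and the choice of q costs only a bounded factor (`floorWords_step`).

When the real part is constant, the floor is P(m) + t or P(m) + t + 1 for an integer polynomial P.
The choice depends on the sign of a sequence whose differences of order D + 1 are nonnegative, like
those of n^c. By the discrete Rolle theorem `signChanges_le` it changes sign at most D + 1 times, so
there are only polynomially many choices (`floorWords_zero`). Hence closeness to an integer needs no
separate treatment. Uniform determinism bounds the words along P + t and P + t + 1. -/

open scoped fwdDiff NNReal

/-! ### Finite differences and Taylor's formula -/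

/-- Iterated differences of a function along an arithmetic progression. -/
lemma fwdDiff_iter_comp_progression (f : ℝ → ℝ) (u v : ℝ) (n m : ℕ) :
    (fwdDiff 1)^[n] (fun i : ℕ => f (u + v * i)) m = (fwdDiff v)^[n] f (u + v * m) := by
  induction n generalizing f with
  | zero => rfl
  | succ n ih =>
    rw [Function.iterate_succ_apply, Function.iterate_succ_apply, ← ih (Δ_[v] f)]
    refine congrArg (fun h => (fwdDiff 1)^[n] h m) (funext fun i => ?_)
    simp only [fwdDiff]
    push_cast
    ring_nf

/-- If the `n`-th derivative of a function is nonnegative on the positive half-line, so are its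
iterated differences of order `n`. -/
lemma fwdDiff_iter_nonneg_of_hasDerivAt (n : ℕ) (g : ℕ → ℝ → ℝ) (v : ℝ) (hv : 0 ≤ v)
    (hg : ∀ i, ∀ t, 0 < t → HasDerivAt (g i) (g (i + 1) t) t)
    (hn : ∀ t, 0 < t → 0 ≤ g n t) (t : ℝ) (ht : 0 < t) : 0 ≤ (fwdDiff v)^[n] (g 0) t := by
  induction n generalizing g with
  | zero => exact hn t ht
  | succ n ih =>
    rw [Function.iterate_succ_apply]
    -- The differences `Δ_[v] (g i)` again form a chain of derivatives, and the `n`-th of them is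
    -- nonnegative because `g n` is increasing.
    refine ih (fun i => Δ_[v] (g i)) (fun i s hs => ?_) (fun s hs => ?_)
    · exact ((hg i (s + v) (by linarith)).comp_add_const s v).sub (hg i s hs)
    · have hmono : MonotoneOn (g n) (Set.Ioi 0) := by
        refine monotoneOn_of_deriv_nonneg (convex_Ioi 0)
          (fun x hx => (hg n x hx).continuousAt.continuousWithinAt)
          (fun x hx => (hg n x (interior_subset hx)).differentiableAt.differentiableWithinAt)
          (fun x hx => ?_)
        rw [(hg n x (interior_subset hx)).deriv]
        exact hn x (interior_subset hx)
      exact sub_nonneg.2 (hmono (Set.mem_Ioi.2 hs) (Set.mem_Ioi.2 (by linarith)) (by linarith))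

/-- A crude form of Taylor's formula. -/
lemma abs_sub_taylor_le (n : ℕ) (g : ℕ → ℝ → ℝ) (t B : ℝ) (ht : 0 < t)
    (hg : ∀ i, ∀ s, 0 < s → HasDerivAt (g i) (g (i + 1) s) s)
    (hB : ∀ s, t ≤ s → |g n s| ≤ B) (y : ℝ) (hy : 0 ≤ y) :
    |g 0 (t + y) - ∑ i ∈ Finset.range n, g i t / (i.factorial : ℝ) * y ^ i| ≤ B * y ^ n := by
  induction n generalizing g y with
  | zero => simpa using hB (t + y) (by linarith)
  | succ n ih =>
    have hB0 : 0 ≤ B := (abs_nonneg _).trans (hB t le_rfl)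
    -- The error `E` vanishes at 0, and its derivative `E'` is the error of order `n` for the
    -- shifted chain `g (· + 1)`, so the mean value inequality gains one power of `y`.
    set E : ℝ → ℝ := fun z => g 0 (t + z) -
      ∑ i ∈ Finset.range (n + 1), g i t / (i.factorial : ℝ) * z ^ i with hE
    set E' : ℝ → ℝ := fun z => g 1 (t + z) -
      ∑ i ∈ Finset.range n, g (i + 1) t / (i.factorial : ℝ) * z ^ i with hE'
    have hd : ∀ z, 0 ≤ z → HasDerivAt E (E' z) z := by
      intro z hz
      refine ((hg 0 (t + z) (by linarith)).comp_const_add t z).sub ?_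
      have := HasDerivAt.fun_sum (u := Finset.range (n + 1)) (x := z)
        (A := fun i z => g i t / (i.factorial : ℝ) * z ^ i)
        (A' := fun i => g i t / (i.factorial : ℝ) * (i * z ^ (i - 1)))
        (fun i _ => (hasDerivAt_pow i z).const_mul _)
      convert this using 1
      rw [Finset.sum_range_succ']
      simp only [Nat.cast_zero, zero_mul, mul_zero, add_zero]
      refine Finset.sum_congr rfl fun i _ => ?_
      rw [Nat.factorial_succ]
      push_cast
      have : (i.factorial : ℝ) ≠ 0 := by positivity
      field_simp
    have hb : ∀ z ∈ Set.Ico 0 y, ‖E' z‖ ≤ B * y ^ n := by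
      intro z hz
      refine (ih (fun i => g (i + 1)) (fun i => hg (i + 1)) hB z hz.1).trans ?_
      exact mul_le_mul_of_nonneg_left (pow_le_pow_left₀ hz.1 hz.2.le n) hB0
    have := norm_image_sub_le_of_norm_deriv_le_segment' (f := E) (f' := E') (a := 0) (b := y)
      (fun z hz => (hd z hz.1).hasDerivWithinAt) hb y ⟨hy, le_rfl⟩
    have hE0 : E 0 = 0 := by
      simp [hE, Finset.sum_range_succ']
    rw [hE0, sub_zero, sub_zero, Real.norm_eq_abs] at this
    rw [pow_succ, ← mul_assoc]
    exact this

/-! ### Sign changes and sign patterns -/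

/-- The number of sign changes of `s` up to `n`. -/
noncomputable def signChanges (s : ℕ → ℝ) (n : ℕ) : ℕ :=
  open Classical in ((Finset.range n).filter fun m => ¬ (0 ≤ s m ↔ 0 ≤ s (m + 1))).card

lemma signChanges_succ (s : ℕ → ℝ) (n : ℕ) [Decidable (0 ≤ s n ↔ 0 ≤ s (n + 1))] :
    signChanges s (n + 1) = signChanges s n + if (0 ≤ s n ↔ 0 ≤ s (n + 1)) then 0 else 1 := by
  classical
  simp only [signChanges, Finset.card_filter, Finset.sum_range_succ]
  congr 1
  split_ifs <;> tauto

/-- When `s` changes sign at `n`, its difference there has the sign that `s` is about to take.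
Between two consecutive changes of `s` the difference must therefore change sign too. The induction
grants the extra 1 only while `s n` and its difference agree in sign. -/
lemma signChanges_le_fwdDiff (s : ℕ → ℝ) (n : ℕ) :
    signChanges s n ≤ signChanges (Δ_[1] s) n + 1 := by
  classical
  suffices h : signChanges s n ≤
      signChanges (Δ_[1] s) n + if (0 ≤ s n ↔ 0 ≤ Δ_[1] s n) then 1 else 0 by
    split_ifs at h <;> omega
  induction n with
  | zero => simp [signChanges]
  | succ n ih =>
    rw [signChanges_succ, signChanges_succ]
    have h1 : Δ_[1] s n = s (n + 1) - s n := rfl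
    have up : s n < 0 → 0 ≤ s (n + 1) → 0 ≤ Δ_[1] s n := fun h h' => by rw [h1]; linarith
    have down : 0 ≤ s n → s (n + 1) < 0 → ¬ 0 ≤ Δ_[1] s n := fun h h' => by rw [h1]; linarith
    generalize Δ_[1] s = r at *
    by_cases a1 : 0 ≤ s n <;> by_cases a2 : 0 ≤ s (n + 1) <;> by_cases a3 : 0 ≤ r n <;>
      by_cases a4 : 0 ≤ r (n + 1) <;> simp only [a1, a2, a3, a4, iff_self, iff_true, iff_false,
        not_true, if_true, if_false] at ih ⊢ <;>
      first
      | omega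
      | exact absurd (up (not_le.1 a1) a2) a3
      | exact absurd a3 (down a1 (not_le.1 a2))

/-- A discrete form of Rolle's theorem. -/
lemma signChanges_le (e : ℕ) (s : ℕ → ℝ) (hs : ∀ m, 0 ≤ (fwdDiff 1)^[e] s m) (n : ℕ) :
    signChanges s n ≤ e := by
  induction e generalizing s with
  | zero =>
    have h : ∀ m, 0 ≤ s m := hs
    simp [signChanges, h]
  | succ e ih =>
    have := ih (Δ_[1] s) hs
    have := signChanges_le_fwdDiff s n
    omega

/-- The set of sign patterns of length `M` with at most `e` sign changes. -/
def signPatterns (e M : ℕ) : Set (Fin M → Bool) :=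
  {p | ∃ s : ℕ → ℝ, signChanges s M ≤ e ∧ ∀ l : Fin M, (p l = true ↔ 0 ≤ s l)}

/-- A pattern is determined by its first sign and the set of at most `e` places where it flips. -/
lemma ncard_signPatterns_le (e M : ℕ) :
    (signPatterns e M).ncard ≤ 2 * ((e + 1) * (M + 1) ^ e) := by
  classical
  let T : Finset (Finset ℕ) :=
    (Finset.range (e + 1)).biUnion fun i => Finset.powersetCard i (Finset.range M)
  have hT : T.card ≤ (e + 1) * (M + 1) ^ e := by
    refine Finset.card_biUnion_le.trans ?_
    refine (Finset.sum_le_card_nsmul _ _ ((M + 1) ^ e) fun i hi => ?_).trans ?_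
    · rw [Finset.card_powersetCard, Finset.card_range]
      refine (Nat.choose_le_pow M i).trans ?_
      refine (Nat.pow_le_pow_left (Nat.le_succ M) i).trans ?_
      exact Nat.pow_le_pow_right (Nat.succ_pos M) (Nat.lt_succ_iff.1 (Finset.mem_range.1 hi))
    · simp
  -- The sign at `l` is the first sign, reversed if the number of flips before `l` is odd.
  let dec : Bool × Finset ℕ → (Fin M → Bool) := fun z l =>
    xor z.1 (decide (((Finset.range l).filter (· ∈ z.2)).card % 2 = 1))
  have hsub : signPatterns e M ⊆ dec '' ((Finset.univ ×ˢ T : Finset (Bool × Finset ℕ)) : Set _) := by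
    rintro p ⟨s, hs, hp⟩
    let B := (Finset.range M).filter fun m => ¬ (0 ≤ s m ↔ 0 ≤ s (m + 1))
    have hB : B.card ≤ e := by
      rw [signChanges] at hs
      convert hs
    refine ⟨(decide (0 ≤ s 0), B), ?_, ?_⟩
    · simp only [Finset.coe_product, Set.mem_prod, Finset.mem_coe, Finset.mem_univ, true_and, T,
        Finset.mem_biUnion, Finset.mem_range, Finset.mem_powersetCard]
      exact ⟨B.card, by omega, Finset.filter_subset _ _, rfl⟩
    · have key : ∀ l < M, xor (decide (0 ≤ s 0))
          (decide (((Finset.range l).filter (· ∈ B)).card % 2 = 1)) = decide (0 ≤ s l) := by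
        intro l
        induction l with
        | zero => simp
        | succ l ih =>
          intro hl
          have ih := ih (by omega)
          rw [Finset.range_add_one, Finset.filter_insert]
          have hmem : l ∈ B ↔ ¬ (0 ≤ s l ↔ 0 ≤ s (l + 1)) := by
            simp only [B, Finset.mem_filter, Finset.mem_range]
            exact ⟨fun h => h.2, fun h => ⟨by omega, h⟩⟩
          split_ifs with h
          · rw [Finset.card_insert_of_notMem (by simp)]
            rw [hmem] at h
            clear hmem
            generalize ((Finset.range l).filter (· ∈ B)).card = r at *
            rcases Nat.mod_two_eq_zero_or_one r with h2 | h2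
            · have : (r + 1) % 2 = 1 := by omega
              rw [h2] at ih
              rw [this]
              by_cases a1 : 0 ≤ s 0 <;> by_cases a2 : 0 ≤ s l <;>
                by_cases a3 : 0 ≤ s (l + 1) <;> simp [a1, a2, a3] at h ih ⊢
            · have : (r + 1) % 2 = 0 := by omega
              rw [h2] at ih
              rw [this]
              by_cases a1 : 0 ≤ s 0 <;> by_cases a2 : 0 ≤ s l <;>
                by_cases a3 : 0 ≤ s (l + 1) <;> simp [a1, a2, a3] at h ih ⊢
          · rw [hmem, not_not] at h
            rw [ih]
            simp only [h]
      funext l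
      refine (key l l.2).trans ?_
      rw [Bool.eq_iff_iff, decide_eq_true_iff]
      exact (hp l).symm
  refine (Set.ncard_le_ncard hsub (Set.toFinite _)).trans ?_
  refine (Set.ncard_image_le (Set.toFinite _)).trans ?_
  rw [Set.ncard_coe_finset, Finset.card_product]
  simpa using hT

/-! ### Counting assembled words -/

/-- If every word of `V` is assembled from `T` words of `W`, in one of `Nat.card Q` ways, then `V`
has at most `Nat.card Q * #W ^ T` elements. -/
lemma ncard_le_of_assembled {A Q : Type*} [Finite Q] {M L T : ℕ} {W : Set (Fin M → A)}
    (hW : W.Finite) {V : Set (Fin L → A)} (idx : Q → Fin L → Fin T) (pos : Q → Fin L → Fin M)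
    (hV : ∀ w ∈ V, ∃ q : Q, ∃ g : Fin T → (Fin M → A), (∀ i, g i ∈ W) ∧
      ∀ l, w l = g (idx q l) (pos q l)) :
    V.Finite ∧ V.ncard ≤ Nat.card Q * W.ncard ^ T := by
  have := hW.to_subtype
  let Φ : Q × (Fin T → W) → (Fin L → A) := fun z l => (z.2 (idx z.1 l)).1 (pos z.1 l)
  have hsub : V ⊆ Set.range Φ := by
    intro w hw
    obtain ⟨q, g, hg, hl⟩ := hV w hw
    exact ⟨(q, fun i => ⟨g i, hg i⟩), funext fun l => (hl l).symm⟩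
  have hfin : (Set.range Φ).Finite := Set.finite_range Φ
  refine ⟨hfin.subset hsub, (Set.ncard_le_ncard hsub hfin).trans ?_⟩
  rw [← Nat.card_coe_set_eq]
  refine (Finite.card_range_le Φ).trans ?_
  rw [Nat.card_prod, Nat.card_fun, Nat.card_coe_set_eq, Nat.card_eq_fintype_card (α := Fin T),
    Fintype.card_fin]

/-! ### Polynomial recurrence modulo 1 -/

/-- Recurrence for monomials: `q ^ j * α` is close to an integer for some `q ≥ 1`. -/
lemma exists_pow_mul_near_int (j : ℕ) (hj : j ≠ 0) (η : ℝ) (hη : 0 < η) (α : ℝ) :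
    ∃ q : ℕ, 1 ≤ q ∧ ∃ z : ℤ, |(q : ℝ) ^ j * α - z| < η := by
  obtain ⟨N, hN⟩ := exists_nat_gt ((2 : ℝ) ^ j * (j.factorial : ℝ) ^ (j - 1) / η)
  have hN0 : (0 : ℝ) < N := lt_of_le_of_lt (by positivity) hN
  have hcol : ∀ y : ℝ, ⌊N * Int.fract y⌋₊ < N := fun y => by
    rw [Nat.floor_lt (by positivity)]
    nlinarith [Int.fract_lt_one y]
  -- Colour `n` by the cell of length `1 / N` containing the fractional part of `α * n ^ j`. Van der
  -- Waerden's theorem gives a monochromatic progression `a * i + b`, `0 ≤ i ≤ j`.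
  obtain ⟨a, ha, b, col, hab⟩ := Combinatorics.exists_mono_homothetic_copy
    (Finset.range (j + 1)) (fun n : ℕ => (⟨_, hcol (α * (n : ℝ) ^ j)⟩ : Fin N))
  let y : ℕ → ℝ := fun i => α * ((a : ℝ) * i + b) ^ j
  have hy : ∀ i ∈ Finset.range (j + 1), ⌊N * Int.fract (y i)⌋₊ = col := by
    intro i hi
    have := congrArg Fin.val (hab i hi)
    simpa [y] using this
  let κ : ℕ → ℤ := fun i => (-1) ^ (j - i) * (j.choose i : ℤ)
  have ha0 : (a : ℝ) ≠ 0 := by positivity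
  -- The `j`-th difference keeps only the leading term. Its coefficients `κ` sum to 0, so the common
  -- cell cancels and the distance to an integer is at most `2 ^ j / N`.
  have hsum : ∑ i ∈ Finset.range (j + 1), (κ i : ℝ) * y i = α * (a : ℝ) ^ j * j.factorial := by
    let p : ℝ[X] := (C (a : ℝ) * X + C (b : ℝ)) ^ j
    have hp1 : (C (a : ℝ) * X + C (b : ℝ)).natDegree = 1 := natDegree_linear ha0
    have hp : p.natDegree = j := by simp only [p, natDegree_pow, hp1, mul_one]
    have hl : p.leadingCoeff = (a : ℝ) ^ j := by
      simp only [p, leadingCoeff_pow, leadingCoeff_linear ha0]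
    have h1 := congrFun (Polynomial.fwdDiff_iter_degree_eq_factorial p) 0
    rw [fwdDiff_iter_eq_sum_shift, hp, hl] at h1
    simp only [p, eval_pow, eval_add, eval_mul, eval_C, eval_X, nsmul_eq_mul, mul_one, zero_add,
      zsmul_eq_mul, Pi.smul_apply, smul_eq_mul, Pi.natCast_apply] at h1
    rw [mul_assoc]
    rw [← h1, Finset.mul_sum]
    refine Finset.sum_congr rfl fun i _ => ?_
    simp only [κ, y]
    push_cast
    ring
  have hκ0 : ∑ i ∈ Finset.range (j + 1), (κ i : ℝ) = 0 := by
    have h1 := congrFun (fwdDiff_iter_pow_eq_zero_of_lt (R := ℝ) (Nat.pos_of_ne_zero hj)) 0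
    rw [fwdDiff_iter_eq_sum_shift] at h1
    simpa [κ] using h1
  have hκ : ∑ i ∈ Finset.range (j + 1), |(κ i : ℝ)| = 2 ^ j := by
    have : ∑ i ∈ Finset.range (j + 1), (j.choose i : ℝ) = 2 ^ j := by
      exact_mod_cast Nat.sum_range_choose j
    rw [← this]
    refine Finset.sum_congr rfl fun i _ => ?_
    simp [κ, abs_mul]
  have hfr : ∀ i ∈ Finset.range (j + 1), |Int.fract (y i) - col / N| ≤ 1 / N := by
    intro i hi
    have h0 : (0 : ℝ) ≤ N * Int.fract (y i) := by positivity
    have h1 := Nat.floor_le h0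
    have h2 := Nat.lt_floor_add_one ((N : ℝ) * Int.fract (y i))
    rw [hy i hi] at h1 h2
    rw [abs_le]
    constructor
    · have : (col : ℝ) / N ≤ Int.fract (y i) := by rw [div_le_iff₀ hN0]; linarith
      have : (0 : ℝ) ≤ 1 / N := by positivity
      linarith
    · have : Int.fract (y i) ≤ ((col : ℝ) + 1) / N := by rw [le_div_iff₀ hN0]; linarith
      rw [add_div] at this
      linarith
  have hz : |α * (a : ℝ) ^ j * j.factorial
      - ((∑ i ∈ Finset.range (j + 1), κ i * ⌊y i⌋ : ℤ) : ℝ)| ≤ 2 ^ j / N := by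
    have : α * (a : ℝ) ^ j * j.factorial - ((∑ i ∈ Finset.range (j + 1), κ i * ⌊y i⌋ : ℤ) : ℝ)
        = ∑ i ∈ Finset.range (j + 1), (κ i : ℝ) * (Int.fract (y i) - col / N) := by
      simp only [mul_sub, Finset.sum_sub_distrib, ← Finset.sum_mul, hκ0, zero_mul, sub_zero]
      rw [← hsum]
      push_cast
      rw [← Finset.sum_sub_distrib]
      refine Finset.sum_congr rfl fun i _ => ?_
      rw [← mul_sub, Int.self_sub_floor]
    rw [this]
    refine (Finset.abs_sum_le_sum_abs _ _).trans ?_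
    rw [← hκ, Finset.sum_div]
    refine Finset.sum_le_sum fun i hi => ?_
    rw [abs_mul, div_eq_mul_one_div |(κ i : ℝ)|]
    exact mul_le_mul_of_nonneg_left (hfr i hi) (abs_nonneg _)
  generalize (∑ i ∈ Finset.range (j + 1), κ i * ⌊y i⌋ : ℤ) = z at hz
  -- Multiplying by `j! ^ (j - 1)` turns `j! * a ^ j` into the perfect power `(j! * a) ^ j`; the
  -- choice of `N` allows for this loss.
  refine ⟨j.factorial * a, Nat.mul_pos (Nat.factorial_pos j) ha, (j.factorial : ℤ) ^ (j - 1) * z, ?_⟩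
  obtain ⟨i, rfl⟩ := Nat.exists_eq_succ_of_ne_zero hj
  have e : ((((i + 1).factorial * a : ℕ) : ℝ)) ^ (i + 1) * α
      - ((((i + 1).factorial : ℤ) ^ (i + 1 - 1) * z : ℤ) : ℝ)
      = ((i + 1).factorial : ℝ) ^ i * (α * (a : ℝ) ^ (i + 1) * (i + 1).factorial - z) := by
    push_cast
    ring
  rw [Nat.succ_eq_add_one, e, abs_mul, abs_of_nonneg (by positivity)]
  refine (mul_le_mul_of_nonneg_left hz (by positivity)).trans_lt ?_
  rw [div_lt_iff₀ hη] at hN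
  rw [← mul_div_assoc, div_lt_iff₀ hN0]
  simp only [Nat.succ_eq_add_one, Nat.add_sub_cancel] at hN ⊢
  linarith

/-- In `exists_pow_mul_near_int` there is a bound for `q` independent of `α`. -/
lemma exists_bound_pow_mul_near_int (j : ℕ) (hj : j ≠ 0) (η : ℝ) (hη : 0 < η) :
    ∃ K : ℕ, ∀ α : ℝ, ∃ q : ℕ, 1 ≤ q ∧ q ≤ K ∧ ∃ z : ℤ, |(q : ℝ) ^ j * α - z| < η := by
  -- Only `α` modulo 1 matters, and these open sets cover the compact interval [0, 1]. The index `q`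
  -- stands for the multiplier `q + 1`.
  let U : ℕ → Set ℝ := fun q => {α | ∃ z : ℤ, |((q + 1 : ℕ) : ℝ) ^ j * α - z| < η}
  have hU : ∀ q, IsOpen (U q) := fun q => by
    have : U q = ⋃ z : ℤ, {α | |((q + 1 : ℕ) : ℝ) ^ j * α - z| < η} := by
      ext; simp [U]
    rw [this]
    exact isOpen_iUnion fun z => isOpen_lt (by fun_prop) continuous_const
  have hcov : Set.Icc (0 : ℝ) 1 ⊆ ⋃ q, U q := by
    intro α _
    obtain ⟨q, hq, z, hz⟩ := exists_pow_mul_near_int j hj η hη α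
    refine Set.mem_iUnion.2 ⟨q - 1, z, ?_⟩
    rwa [Nat.sub_add_cancel hq]
  obtain ⟨t, ht⟩ := isCompact_Icc.elim_finite_subcover U hU hcov
  refine ⟨t.sup id + 1, fun α => ?_⟩
  have := ht ⟨Int.fract_nonneg α, (Int.fract_lt_one α).le⟩
  simp only [Set.mem_iUnion] at this
  obtain ⟨q, hq, z, hz⟩ := this
  refine ⟨q + 1, by omega, Nat.succ_le_succ (Finset.le_sup (f := id) hq),
    z + ((q + 1 : ℕ) : ℤ) ^ j * ⌊α⌋, ?_⟩
  have e : ((q + 1 : ℕ) : ℝ) ^ j * α - ((z + ((q + 1 : ℕ) : ℤ) ^ j * ⌊α⌋ : ℤ) : ℝ)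
      = ((q + 1 : ℕ) : ℝ) ^ j * Int.fract α - z := by
    rw [← Int.self_sub_floor]
    push_cast
    ring
  rwa [e]

/-! ### Reducing the degree of the real part -/

/-- All differences of order `e` of `x`, along all arithmetic progressions, are nonnegative. -/
def DiffNonneg (e : ℕ) (x : ℕ → ℝ) : Prop :=
  ∀ r q m : ℕ, 0 ≤ (fwdDiff 1)^[e] (fun i => x (r + q * i)) m

/-- A progression inside a progression is again one, so the property survives the repeated passage
to progressions in the degree reduction. -/
lemma DiffNonneg.progression {e : ℕ} {x : ℕ → ℝ} (hx : DiffNonneg e x) (r q : ℕ) :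
    DiffNonneg e (fun i => x (r + q * i)) := by
  intro r' q' m
  have e : (fun i => x (r + q * (r' + q' * i))) = fun i => x (r + q * r' + q * q' * i) := by
    funext i
    congr 1
    ring
  simp only [e]
  exact hx (r + q * r') (q * q') m

/-- On `{0, …, M - 1}`, the sequence `x` is within `δ` of the sum of a polynomial of degree at most
`d` with natural coefficients and a polynomial of degree at most `j` with nonnegative real
coefficients. -/
def NearPolynomial (d j M : ℕ) (δ : ℝ) (x : ℕ → ℝ) : Prop :=
  ∃ (P : ℕ[X]) (R : ℝ≥0[X]), P.natDegree ≤ d ∧ R.natDegree ≤ j ∧ 1 ≤ R.coeff 0 ∧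
    ∀ m < M, |x m - ((P.eval m : ℕ) + (R.eval (m : ℝ≥0) : ℝ≥0))| ≤ δ

/-- The words `(a ⌊x l⌋)_{0 ≤ l < M}` for `x` as in `DiffNonneg` and `NearPolynomial`. -/
def floorWords {A : Type*} (a : ℕ → A) (d j M : ℕ) (δ : ℝ) : Set (Fin M → A) :=
  {w | ∃ x : ℕ → ℝ, DiffNonneg (d + 1) x ∧ NearPolynomial d j M δ x ∧
    w = fun l : Fin M => a ⌊x l⌋₊}

lemma coeff_comp_linear (R : ℝ≥0[X]) (j : ℕ) (hR : R.natDegree ≤ j) (q r : ℝ≥0) (hq : q ≠ 0) :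
    (R.comp (C q * X + C r)).coeff j = R.coeff j * q ^ j := by
  have h1 : (C q * X + C r).natDegree = 1 := natDegree_linear hq
  rcases hR.eq_or_lt with rfl | hlt
  · have := coeff_comp_degree_mul_degree (p := R) (q := C q * X + C r) (by rw [h1]; exact one_ne_zero)
    rwa [h1, mul_one, leadingCoeff_linear hq] at this
  · rw [coeff_eq_zero_of_natDegree_lt hlt, zero_mul]
    refine coeff_eq_zero_of_natDegree_lt (lt_of_le_of_lt natDegree_comp_le ?_)
    rwa [h1, mul_one]

/-- If `q ^ j` times the leading coefficient of the real part is close to an integer, then the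
degree of the real part drops along progressions with difference `q`. -/
lemma nearPolynomial_progression {d j M L : ℕ} {δ η : ℝ} {x : ℕ → ℝ} (hjd : j + 1 ≤ d)
    {P : ℕ[X]} {R : ℝ≥0[X]} (hP : P.natDegree ≤ d) (hR : R.natDegree ≤ j + 1)
    (hR0 : 1 ≤ R.coeff 0)
    (hx : ∀ m < L, |x m - ((P.eval m : ℕ) + (R.eval (m : ℝ≥0) : ℝ≥0))| ≤ δ)
    {q z : ℕ} (hq : 1 ≤ q) (hz : |(q : ℝ) ^ (j + 1) * R.coeff (j + 1) - z| ≤ η)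
    {r : ℕ} (hr : r + q * M < L + q) :
    NearPolynomial d j M (δ + η * (M : ℝ) ^ (j + 1)) (fun i => x (r + q * i)) := by
  have hq0 : q ≠ 0 := by omega
  set R' : ℝ≥0[X] := R.comp (C (q : ℝ≥0) * X + C (r : ℝ≥0)) with hR'
  have hdeg : R'.natDegree ≤ j + 1 := by
    refine natDegree_comp_le.trans ?_
    rw [natDegree_linear (by exact_mod_cast hq0), mul_one]
    exact hR
  have hcoeff : R'.coeff (j + 1) = R.coeff (j + 1) * (q : ℝ≥0) ^ (j + 1) :=
    coeff_comp_linear R (j + 1) hR _ _ (by exact_mod_cast hq0)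
  -- The top coefficient of `R'` is within `η` of `z`, so `z * X ^ (j + 1)` moves to the integer
  -- part at a cost of at most `η * M ^ (j + 1)`. The new constant coefficient is `R` evaluated at
  -- `r`, which is at least `R.coeff 0` since all coefficients are nonnegative.
  refine ⟨P.comp (C q * X + C r) + monomial (j + 1) z, R'.erase (j + 1), ?_, ?_, ?_, ?_⟩
  · refine (natDegree_add_le _ _).trans (max_le ?_ ((natDegree_monomial_le _).trans hjd))
    refine natDegree_comp_le.trans ?_
    rw [natDegree_linear hq0, mul_one]
    exact hP
  · rw [natDegree_le_iff_coeff_eq_zero]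
    intro i hi
    rcases Nat.lt_or_ge (j + 1) i with h | h
    · rw [erase_ne _ (by omega), coeff_eq_zero_of_natDegree_lt (by omega)]
    · rw [show i = j + 1 by omega, erase_same]
  · rw [erase_ne _ (by omega), coeff_zero_eq_eval_zero, hR', eval_comp]
    simp only [eval_add, eval_mul, eval_C, eval_X, mul_zero, zero_add]
    rw [eval_eq_sum_range, Finset.sum_range_succ', pow_zero, mul_one]
    exact hR0.trans le_add_self
  · intro m hm
    have hrm : r + q * m < L := by
      have : q * m + q ≤ q * M := by
        rw [← Nat.mul_succ]; exact Nat.mul_le_mul_left q hm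
      omega
    have h1 := hx (r + q * m) hrm
    have h2 : R'.eval (m : ℝ≥0) = R'.coeff (j + 1) * (m : ℝ≥0) ^ (j + 1)
        + (R'.erase (j + 1)).eval (m : ℝ≥0) := by
      conv_lhs => rw [← monomial_add_erase R' (j + 1)]
      rw [eval_add, eval_monomial]
    have h3 : R'.eval (m : ℝ≥0) = R.eval ((r + q * m : ℕ) : ℝ≥0) := by
      rw [hR', eval_comp]
      simp only [eval_add, eval_mul, eval_C, eval_X]
      push_cast
      rw [add_comm]
    rw [← h3, h2, hcoeff] at h1
    have h4 : (P.comp (C q * X + C r) + monomial (j + 1) z).eval m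
        = P.eval (r + q * m) + z * m ^ (j + 1) := by
      rw [eval_add, eval_comp, eval_monomial]
      simp only [eval_add, eval_mul, eval_C, eval_X]
      rw [add_comm (q * m)]
    rw [h4]
    have h5 : |(q : ℝ) ^ (j + 1) * R.coeff (j + 1) - z| * (m : ℝ) ^ (j + 1)
        ≤ η * (M : ℝ) ^ (j + 1) := by
      have hη : 0 ≤ η := (abs_nonneg _).trans hz
      have : (m : ℝ) ≤ M := by exact_mod_cast hm.le
      gcongr
    have h6 : x (r + q * m) - (((P.eval (r + q * m) + z * m ^ (j + 1) : ℕ) : ℝ)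
          + ((R'.erase (j + 1)).eval (m : ℝ≥0) : ℝ≥0))
        = (x (r + q * m) - (((P.eval (r + q * m) : ℕ) : ℝ)
          + ((R.coeff (j + 1) * (q : ℝ≥0) ^ (j + 1) * (m : ℝ≥0) ^ (j + 1)
            + (R'.erase (j + 1)).eval (m : ℝ≥0) : ℝ≥0) : ℝ)))
          + ((q : ℝ) ^ (j + 1) * R.coeff (j + 1) - z) * (m : ℝ) ^ (j + 1) := by
      push_cast
      ring
    rw [h6]
    refine (abs_add_le _ _).trans (add_le_add h1 ?_)
    rw [abs_mul, abs_of_nonneg (by positivity : (0 : ℝ) ≤ (m : ℝ) ^ (j + 1))]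
    exact h5

lemma natCast_pow_le_exp {n M T : ℕ} {ε : ℝ} (h : (n : ℝ) ≤ Real.exp (ε * M)) :
    (n : ℝ) ^ T ≤ Real.exp (ε * (M * T)) := by
  refine (pow_le_pow_left₀ (Nat.cast_nonneg n) h T).trans_eq ?_
  rw [← Real.exp_nat_mul]
  ring_nf

/-- Degree reduction: the words of level `j + 1` are assembled from words of level `j`. -/
lemma floorWords_step {A : Type*} (a : ℕ → A) (d j : ℕ) (hjd : j + 1 ≤ d)
    (ih : ∀ ε : ℝ, 0 < ε → ∃ M : ℕ, 1 ≤ M ∧ ∃ δ : ℝ, 0 < δ ∧ (floorWords a d j M δ).Finite ∧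
      ((floorWords a d j M δ).ncard : ℝ) ≤ Real.exp (ε * M)) (ε : ℝ) (hε : 0 < ε) :
    ∃ M : ℕ, 1 ≤ M ∧ ∃ δ : ℝ, 0 < δ ∧ (floorWords a d (j + 1) M δ).Finite ∧
      ((floorWords a d (j + 1) M δ).ncard : ℝ) ≤ Real.exp (ε * M) := by
  obtain ⟨M, hM, δ, hδ, hfin, hcard⟩ := ih (ε / 2) (by positivity)
  have hM0 : (0 : ℝ) < M := by exact_mod_cast hM
  -- The second bound keeps the new error within `δ / 2`; the bound 1 makes the nearby integer `z`
  -- nonnegative below.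
  set η : ℝ := min 1 (δ / 2 / (M : ℝ) ^ (j + 1)) with hη
  obtain ⟨K, hK⟩ := exists_bound_pow_mul_near_int (j + 1) (by omega) η (by positivity)
  obtain ⟨T, hT⟩ := exists_nat_ge (K / (ε / 2))
  -- Since `N` is divisible by every `q ≤ K`, a window of length `M * N` splits exactly into blocks
  -- of length `q * M`, and each block into `q` progressions of length `M`. The factor `T + 1` makes
  -- the window long enough to absorb the `K` choices of `q`.
  set F := K.factorial with hF
  have hF1 : 1 ≤ F := Nat.factorial_pos K
  set N := F * (T + 1) with hN
  have hlt : ∀ (q : Fin K) (l : Fin (M * N)), ∃ n, N = ((q : ℕ) + 1) * n ∧ (l : ℕ) / (((q : ℕ) + 1) * M) < n := by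
    intro q l
    obtain ⟨n, hn⟩ : ((q : ℕ) + 1) ∣ N :=
      (Nat.dvd_factorial (Nat.succ_pos _) q.2).trans (Dvd.intro _ rfl)
    refine ⟨n, hn, ?_⟩
    rw [Nat.div_lt_iff_lt_mul (by positivity)]
    calc (l : ℕ) < M * N := l.2
      _ = n * (((q : ℕ) + 1) * M) := by rw [hn]; ring
  -- `idx` numbers the progression containing `l` (block, then residue) and `pos` is the place of
  -- `l` in it; `q : Fin K` stands for the difference `q + 1`.
  let idx : Fin K → Fin (M * N) → Fin N := fun q l =>
    ⟨((l : ℕ) / (((q : ℕ) + 1) * M)) * ((q : ℕ) + 1) + ((l : ℕ) % (((q : ℕ) + 1) * M)) % ((q : ℕ) + 1), by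
      obtain ⟨n, hn, hl⟩ := hlt q l
      have h1 : ((l : ℕ) % (((q : ℕ) + 1) * M)) % ((q : ℕ) + 1) < ((q : ℕ) + 1) := Nat.mod_lt _ (Nat.succ_pos _)
      have h2 : ((l : ℕ) / (((q : ℕ) + 1) * M) + 1) * ((q : ℕ) + 1) ≤ n * ((q : ℕ) + 1) := Nat.mul_le_mul_right _ hl
      have h3 : N = n * ((q : ℕ) + 1) := hn.trans (mul_comm _ _)
      rw [add_mul, one_mul, ← h3] at h2
      omega⟩
  let pos : Fin K → Fin (M * N) → Fin M := fun q l =>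
    ⟨((l : ℕ) % (((q : ℕ) + 1) * M)) / ((q : ℕ) + 1), by
      rw [Nat.div_lt_iff_lt_mul (Nat.succ_pos _)]
      exact (Nat.mod_lt _ (by positivity)).trans_eq (mul_comm _ _)⟩
  have hV := ncard_le_of_assembled (V := floorWords a d (j + 1) (M * N) (δ / 2)) hfin idx pos ?_
  · refine ⟨M * N, Nat.mul_pos hM (Nat.mul_pos hF1 (Nat.succ_pos T)), δ / 2, by positivity, hV.1, ?_⟩
    have h1 : ((floorWords a d (j + 1) (M * N) (δ / 2)).ncard : ℝ)
        ≤ K * ((floorWords a d j M δ).ncard : ℝ) ^ N := by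
      have := hV.2
      rw [Nat.card_eq_fintype_card, Fintype.card_fin] at this
      exact_mod_cast this
    refine h1.trans ?_
    have h2 := natCast_pow_le_exp (T := N) hcard
    have h3 : (K : ℝ) ≤ Real.exp (ε / 2 * (M * N)) := by
      have h4 : (K : ℝ) ≤ T * (ε / 2) := by rwa [div_le_iff₀ (by positivity)] at hT
      have h5 : T ≤ M * N := by
        calc T ≤ T + 1 := Nat.le_succ T
          _ ≤ F * (T + 1) := Nat.le_mul_of_pos_left _ hF1
          _ ≤ M * N := Nat.le_mul_of_pos_left _ hM
      have h6 : (T : ℝ) ≤ M * N := by exact_mod_cast h5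
      have h7 := Real.add_one_le_exp (ε / 2 * (M * N))
      nlinarith
    calc (K : ℝ) * ((floorWords a d j M δ).ncard : ℝ) ^ N
        ≤ Real.exp (ε / 2 * (M * N)) * Real.exp (ε / 2 * (M * N)) :=
          mul_le_mul h3 h2 (by positivity) (by positivity)
      _ = Real.exp (ε * ((M * N : ℕ) : ℝ)) := by
          rw [← Real.exp_add]
          push_cast
          ring_nf
  · rintro w ⟨x, hx, ⟨P, R, hP, hR, hR0, hPR⟩, rfl⟩
    obtain ⟨q, hq1, hqK, z, hz⟩ := hK (R.coeff (j + 1))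
    have hz0 : 0 ≤ z := by
      have h1 : (0 : ℝ) ≤ (q : ℝ) ^ (j + 1) * R.coeff (j + 1) := by positivity
      have h2 := (abs_lt.1 hz).2
      have h3 : η ≤ 1 := min_le_left _ _
      have h4 : (-1 : ℝ) < z := by linarith
      have h5 : (-1 : ℤ) < z := by exact_mod_cast h4
      omega
    lift z to ℕ using hz0
    obtain ⟨p, rfl⟩ : ∃ p, q = p + 1 := ⟨q - 1, by omega⟩
    let r : ℕ → ℕ := fun i => (i / (p + 1)) * ((p + 1) * M) + i % (p + 1)
    refine ⟨⟨p, hqK⟩, fun i m => a ⌊x (r i + (p + 1) * m)⌋₊, fun i => ?_, fun l => ?_⟩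
    · refine ⟨_, hx.progression (r i) (p + 1), ?_, rfl⟩
      have hr : r i + (p + 1) * M < M * N + (p + 1) := by
        obtain ⟨n, hn⟩ : (p + 1 : ℕ) ∣ N :=
          (Nat.dvd_factorial (Nat.succ_pos _) hqK).trans (Dvd.intro _ rfl)
        have h1 : (i : ℕ) / (p + 1) < n := by
          rw [Nat.div_lt_iff_lt_mul (Nat.succ_pos _), mul_comm, ← hn]
          exact i.2
        have h2 : ((i : ℕ) / (p + 1) + 1) * ((p + 1) * M) ≤ n * ((p + 1) * M) :=
          Nat.mul_le_mul_right _ h1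
        have h3 : (i : ℕ) % (p + 1) < p + 1 := Nat.mod_lt _ (Nat.succ_pos _)
        have h4 : M * N = n * ((p + 1) * M) := by rw [hn]; ring
        rw [add_mul, one_mul] at h2
        simp only [r]
        omega
      obtain ⟨P', R', h1, h2, h3, h4⟩ :=
        nearPolynomial_progression hjd hP hR hR0 hPR hq1 hz.le hr
      refine ⟨P', R', h1, h2, h3, fun m hm => (h4 m hm).trans ?_⟩
      have h5 : η ≤ δ / 2 / (M : ℝ) ^ (j + 1) := min_le_right _ _
      rw [le_div_iff₀ (by positivity)] at h5
      linarith
    · have hl : (l : ℕ) = r (idx ⟨p, hqK⟩ l) + (p + 1) * (pos ⟨p, hqK⟩ l) := by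
        simp only [r, idx, pos]
        have h1 := Nat.div_add_mod (l : ℕ) ((p + 1) * M)
        have h2 := Nat.div_add_mod ((l : ℕ) % ((p + 1) * M)) (p + 1)
        have h3 : ((l : ℕ) % ((p + 1) * M)) % (p + 1) < p + 1 := Nat.mod_lt _ (Nat.succ_pos _)
        rw [Nat.mul_add_mod_of_lt h3, mul_comm (_ / _) (p + 1), Nat.mul_add_div (Nat.succ_pos p),
          Nat.div_eq_of_lt h3, add_zero,
          mul_comm ((l : ℕ) / ((p + 1) * M)) ((p + 1) * M)]
        omega
      simp only
      rw [← hl]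

/-! ### Constant real part -/

lemma SubexponentialGrowth.eventually_le_exp {A : Type*} {S : (H : ℕ) → Set (Fin H → A)}
    (hS : SubexponentialGrowth S) {ε : ℝ} (hε : 0 < ε) :
    ∀ᶠ H : ℕ in atTop, ((S H).ncard : ℝ) ≤ Real.exp (ε * H) := by
  filter_upwards [hS.2.eventually_lt_const hε, eventually_gt_atTop 0] with H h hH
  rcases Nat.eq_zero_or_pos (S H).ncard with h0 | h0
  · rw [h0]; simpa using (Real.exp_pos _).le
  · rw [← Real.log_le_iff_le_exp (by exact_mod_cast h0)]
    have : (0 : ℝ) < H := by exact_mod_cast hH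
    rw [one_div, inv_mul_lt_iff₀ this] at h
    linarith

lemma eventually_pow_le_exp (e : ℕ) {ε : ℝ} (hε : 0 < ε) :
    ∀ᶠ M : ℕ in atTop, ((2 * ((e + 1) * (M + 1) ^ e) : ℕ) : ℝ) ≤ Real.exp (ε * M) := by
  have h := (isLittleO_pow_exp_pos_mul_atTop e hε).bound
    (show 0 < Real.exp (-ε) / (2 * (e + 1)) by positivity)
  have ht : Tendsto (fun M : ℕ => (M : ℝ) + 1) atTop atTop :=
    tendsto_atTop_add_const_right _ _ tendsto_natCast_atTop_atTop
  filter_upwards [ht.eventually h] with M hM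
  rw [Real.norm_of_nonneg (by positivity), Real.norm_of_nonneg (by positivity), div_mul_eq_mul_div,
    le_div_iff₀ (by positivity), ← Real.exp_add] at hM
  push_cast
  calc 2 * (((e : ℝ) + 1) * ((M : ℝ) + 1) ^ e) = ((M : ℝ) + 1) ^ e * (2 * (e + 1)) := by ring
    _ ≤ _ := hM
    _ = _ := by ring_nf

lemma mem_subwordsAlongPolynomials {A : Type*} (a : ℕ → A) {d D : ℕ} (hD : D ≤ d) (M : ℕ)
    (P : ℕ[X]) (hP : P.natDegree ≤ D) (t : ℕ) :
    (fun l : Fin M => a (P.eval (l : ℕ) + t)) ∈ subwordsAlongPolynomials a d M := by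
  have heval : ∀ n : ℕ, ((P + C t).map (Nat.castRingHom ℤ)).eval (n : ℤ)
      = ((P.eval n + t : ℕ) : ℤ) := fun n => by
    rw [eval_natCast_map]
    simp
  refine ⟨0, (P + C t).map (Nat.castRingHom ℤ), ⟨?_, fun n => ?_⟩, ?_⟩
  · refine degree_map_le.trans (natDegree_le_iff_degree_le.1 ?_)
    rw [natDegree_add_C]
    exact hP.trans hD
  · rw [heval]
    positivity
  · funext l
    rw [zero_add, heval, Int.toNat_natCast]

/-- The case of constant real part: up to a sign pattern with few sign changes, only two words along
integer polynomials occur. -/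
lemma floorWords_zero {A : Type*} (a : ℕ → A) {d D : ℕ} (hD : D ≤ d)
    (hdet : IsUniformlyDeterministic a d) (ε : ℝ) (hε : 0 < ε) :
    ∃ M : ℕ, 1 ≤ M ∧ ∃ δ : ℝ, 0 < δ ∧ (floorWords a D 0 M δ).Finite ∧
      ((floorWords a D 0 M δ).ncard : ℝ) ≤ Real.exp (ε * M) := by
  -- The two polynomial words cost `ε / 4` each, the sign pattern `ε / 2`.
  obtain ⟨M, ⟨h1, h2⟩, hM⟩ := ((hdet.eventually_le_exp (show 0 < ε / 4 by positivity)).and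
    (eventually_pow_le_exp (D + 1) (show 0 < ε / 2 by positivity))
    |>.and (eventually_ge_atTop 1)).exists
  have hV := ncard_le_of_assembled (Q := signPatterns (D + 1) M) (T := 2) (hdet.1 M)
    (V := floorWords a D 0 M (1 / 4)) (fun p l => if p.1 l = true then 1 else 0) (fun _ l => l) ?_
  · refine ⟨M, hM, 1 / 4, by norm_num, hV.1, ?_⟩
    have h3 : ((floorWords a D 0 M (1 / 4)).ncard : ℝ) ≤ ((2 * ((D + 1 + 1) * (M + 1) ^ (D + 1)) : ℕ) : ℝ)
        * ((subwordsAlongPolynomials a d M).ncard : ℝ) ^ 2 := by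
      have := hV.2.trans (Nat.mul_le_mul_right _ (ncard_signPatterns_le (D + 1) M))
      exact_mod_cast this
    refine h3.trans ?_
    calc _ ≤ Real.exp (ε / 2 * M) * Real.exp (ε / 4 * (M * (2 : ℕ))) :=
          mul_le_mul h2 (natCast_pow_le_exp h1) (by positivity) (by positivity)
      _ = _ := by
          rw [← Real.exp_add]
          push_cast
          ring_nf
  · rintro w ⟨x, hx, ⟨P, R, hP, hR, hR0, hPR⟩, rfl⟩
    set β : ℝ := NNReal.toReal (R.coeff 0) with hβ
    have hβ1 : 1 ≤ β := by exact_mod_cast hR0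
    have hR' : ∀ y, R.eval y = R.coeff 0 := fun y => by
      rw [eq_C_of_natDegree_le_zero hR]; simp
    -- The condition `1 ≤ R.coeff 0` is needed so that the natural-number floor below is the true
    -- floor.
    have ht0 : 0 ≤ β - 1 / 4 := by linarith
    set t := ⌊β - 1 / 4⌋₊ with ht
    have ht1 : (t : ℝ) ≤ β - 1 / 4 := Nat.floor_le ht0
    have ht2 : β - 1 / 4 < t + 1 := Nat.lt_floor_add_one _
    -- The error 1/4 places `x m` in `[P m + t, P m + t + 2)`. Its floor is thus `P m + t + 1` or `P
    -- m + t`, according to the sign of `x - Q`.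
    let Q : ℝ[X] := P.map (Nat.castRingHom ℝ) + C ((t : ℝ) + 1)
    have hQ : ∀ m : ℕ, Q.eval (m : ℝ) = ((P.eval m : ℕ) : ℝ) + (t + 1) := fun m => by
      simp only [Q, eval_add, eval_natCast_map, eval_C]
      simp
    let s : ℕ → ℝ := fun m => x m - Q.eval (m : ℝ)
    have hs : ∀ m, 0 ≤ (fwdDiff 1)^[D + 1] s m := by
      intro m
      have hQD : Q.natDegree < D + 1 := by
        rw [Nat.lt_succ_iff, natDegree_add_C]
        exact natDegree_map_le.trans hP
      have e1 : x = s + fun m : ℕ => Q.eval (0 + 1 * (m : ℝ)) := by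
        funext m
        simp [s]
      have e2 : (fwdDiff 1)^[D + 1] x m = (fwdDiff 1)^[D + 1] s m := by
        conv_lhs => rw [e1]
        rw [fwdDiff_iter_add, Pi.add_apply, fwdDiff_iter_comp_progression (fun y => Q.eval y)]
        rw [fwdDiff_iter_eq_zero_of_degree_lt hQD]
        simp
      rw [← e2]
      simpa using hx 0 1 m
    classical
    refine ⟨⟨fun l => decide (0 ≤ s l), s, signChanges_le (D + 1) s hs M, fun l => by simp⟩,
      fun i l => a (P.eval (l : ℕ) + (t + i)), fun i => ?_, fun l => ?_⟩
    · exact mem_subwordsAlongPolynomials a hD M P hP _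
    · have h4 := abs_le.1 (hPR l l.2)
      rw [hR', ← hβ] at h4
      simp only [decide_eq_true_eq]
      refine congrArg a ?_
      have hx0 : 0 ≤ x l := by
        have : (0 : ℝ) ≤ ((P.eval (l : ℕ) : ℕ) : ℝ) := Nat.cast_nonneg _
        linarith [h4.1]
      rw [Nat.floor_eq_iff hx0]
      by_cases hsl : 0 ≤ s l
      · rw [if_pos hsl]
        simp only [s, hQ] at hsl
        push_cast
        simp only [Fin.val_one, Nat.cast_one]
        constructor <;> linarith [h4.2]
      · rw [if_neg hsl]
        simp only [s, hQ] at hsl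
        push_cast
        simp only [Fin.val_zero, Nat.cast_zero]
        constructor <;> linarith [h4.1]

/-- Induction on the degree of the real part, for all `ε` at once because each reduction halves `ε`.
-/
theorem exists_floorWords_ncard_le {A : Type*} (a : ℕ → A) {d D : ℕ} (hD : D ≤ d)
    (hdet : IsUniformlyDeterministic a d) (j : ℕ) (hj : j ≤ D) (ε : ℝ) (hε : 0 < ε) :
    ∃ M : ℕ, 1 ≤ M ∧ ∃ δ : ℝ, 0 < δ ∧ (floorWords a D j M δ).Finite ∧
      ((floorWords a D j M δ).ncard : ℝ) ≤ Real.exp (ε * M) := by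
  induction j generalizing ε with
  | zero => exact floorWords_zero a hD hdet ε hε
  | succ j ih => exact floorWords_step a D j hj (fun ε hε => ih (by omega) ε hε) ε hε

/-! ### The power function -/

/-- The `i`-th derivative of `t ↦ t ^ c` at `t > 0`. -/
noncomputable def rpowDeriv (c : ℝ) (i : ℕ) (t : ℝ) : ℝ :=
  (∏ m ∈ Finset.range i, (c - m)) * t ^ (c - i)

lemma rpowDeriv_zero (c t : ℝ) : rpowDeriv c 0 t = t ^ c := by
  simp [rpowDeriv]

lemma hasDerivAt_rpowDeriv (c : ℝ) (i : ℕ) (t : ℝ) (ht : 0 < t) :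
    HasDerivAt (rpowDeriv c i) (rpowDeriv c (i + 1) t) t := by
  refine ((Real.hasDerivAt_rpow_const (p := c - i) (Or.inl ht.ne')).const_mul _).congr_deriv ?_
  rw [rpowDeriv, Finset.prod_range_succ]
  push_cast
  rw [sub_sub, mul_assoc]

lemma prod_range_sub_nonneg {c : ℝ} (hc : 0 ≤ c) {i : ℕ} (hi : i ≤ ⌊c⌋₊ + 1) :
    0 ≤ ∏ m ∈ Finset.range i, (c - m) := by
  refine Finset.prod_nonneg fun m hm => sub_nonneg.2 ?_
  have : m ≤ ⌊c⌋₊ := by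
    have := Finset.mem_range.1 hm
    omega
  exact (Nat.cast_le.2 this).trans (Nat.floor_le hc)

lemma rpowDeriv_nonneg {c : ℝ} (hc : 0 ≤ c) {i : ℕ} (hi : i ≤ ⌊c⌋₊ + 1) {t : ℝ} (ht : 0 < t) :
    0 ≤ rpowDeriv c i t :=
  mul_nonneg (prod_range_sub_nonneg hc hi) (Real.rpow_nonneg ht.le _)

/-- The derivative of order ⌊c⌋ + 1 has the coefficient c(c − 1)⋯(c − ⌊c⌋), a product of nonnegative
factors. -/
lemma diffNonneg_rpow {c : ℝ} (hc : 0 ≤ c) {n : ℕ} (hn : 1 ≤ n) :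
    DiffNonneg (⌊c⌋₊ + 1) (fun i => ((n + i : ℕ) : ℝ) ^ c) := by
  intro r q m
  have hn0 : (0 : ℝ) < n := by exact_mod_cast hn
  have h := fwdDiff_iter_comp_progression (rpowDeriv c 0) ((n : ℝ) + r) q (⌊c⌋₊ + 1) m
  have e : (fun i : ℕ => ((n + (r + q * i) : ℕ) : ℝ) ^ c)
      = fun i : ℕ => rpowDeriv c 0 ((n : ℝ) + r + q * i) := by
    funext i
    rw [rpowDeriv_zero]
    push_cast
    ring_nf
  simp only [e]
  rw [h]
  exact fwdDiff_iter_nonneg_of_hasDerivAt (⌊c⌋₊ + 1) (rpowDeriv c) q (Nat.cast_nonneg q)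
    (hasDerivAt_rpowDeriv c) (fun t ht => rpowDeriv_nonneg hc le_rfl ht) _ (by positivity)

/-- Taylor approximation of `t ↦ t ^ c` on windows far from the origin. -/
lemma eventually_nearPolynomial_rpow {c : ℝ} (hc : 0 ≤ c) (M : ℕ) {δ : ℝ} (hδ : 0 < δ) :
    ∀ᶠ n : ℕ in atTop,
      NearPolynomial ⌊c⌋₊ ⌊c⌋₊ M δ (fun i => ((n + i : ℕ) : ℝ) ^ c) := by
  set D := ⌊c⌋₊ with hD
  have hcD : 0 < (D + 1 : ℕ) - c := by
    have := Nat.lt_floor_add_one c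
    push_cast
    linarith
  -- The Taylor error on a window of fixed length decays because `c - (D + 1) < 0`.
  have hlim : Tendsto (fun n : ℕ => rpowDeriv c (D + 1) n * (M : ℝ) ^ (D + 1)) atTop (𝓝 0) := by
    have h1 := (tendsto_rpow_neg_atTop hcD).comp tendsto_natCast_atTop_atTop (α := ℕ)
    have h2 := (h1.const_mul (∏ m ∈ Finset.range (D + 1), (c - m))).mul_const ((M : ℝ) ^ (D + 1))
    rw [mul_zero, zero_mul] at h2
    refine h2.congr fun n => ?_
    simp only [rpowDeriv, Function.comp_apply, neg_sub]
  filter_upwards [hlim.eventually_lt_const hδ, eventually_ge_atTop 1] with n hn hn1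
  have hn0 : (0 : ℝ) < n := by exact_mod_cast hn1
  let κ : ℕ → ℝ≥0 := fun i => (rpowDeriv c i n / (i.factorial : ℝ)).toNNReal
  -- The integer part starts at 0 and the whole Taylor polynomial is the real part; the degree
  -- reduction fills the integer part later.
  refine ⟨0, ∑ i ∈ Finset.range (D + 1), monomial i (κ i), by simp, ?_, ?_, fun m hm => ?_⟩
  · refine natDegree_sum_le_of_forall_le _ _ fun i hi => (natDegree_monomial_le _).trans ?_
    exact Nat.lt_succ_iff.1 (Finset.mem_range.1 hi)
  · have : (∑ i ∈ Finset.range (D + 1), monomial i (κ i)).coeff 0 = κ 0 := by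
      simp [coeff_monomial]
    rw [this]
    simp only [κ, rpowDeriv_zero, Nat.factorial_zero, Nat.cast_one, div_one]
    rw [Real.one_le_toNNReal]
    exact Real.one_le_rpow (by exact_mod_cast hn1) hc
  · have hB : ∀ s, (n : ℝ) ≤ s → |rpowDeriv c (D + 1) s| ≤ rpowDeriv c (D + 1) n := by
      intro s hs
      rw [abs_of_nonneg (rpowDeriv_nonneg hc le_rfl (hn0.trans_le hs))]
      exact mul_le_mul_of_nonneg_left
        (Real.rpow_le_rpow_of_nonpos hn0 hs (by linarith)) (prod_range_sub_nonneg hc le_rfl)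
    have h := abs_sub_taylor_le (D + 1) (rpowDeriv c) n _ hn0 (hasDerivAt_rpowDeriv c) hB m
      (Nat.cast_nonneg m)
    have e : NNReal.toReal ((∑ i ∈ Finset.range (D + 1), monomial i (κ i)).eval (m : ℝ≥0))
        = ∑ i ∈ Finset.range (D + 1), rpowDeriv c i n / (i.factorial : ℝ) * (m : ℝ) ^ i := by
      rw [eval_finsetSum]
      push_cast
      refine Finset.sum_congr rfl fun i hi => ?_
      rw [eval_monomial]
      push_cast
      rw [Real.coe_toNNReal]
      exact div_nonneg (rpowDeriv_nonneg hc (Finset.mem_range.1 hi).le hn0) (Nat.cast_nonneg _)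
    rw [e]
    simp only [eval_zero, Nat.cast_zero, zero_add, rpowDeriv_zero] at h ⊢
    push_cast
    refine h.trans (le_trans ?_ hn.le)
    have : (m : ℝ) ≤ M := by exact_mod_cast hm.le
    have := rpowDeriv_nonneg hc le_rfl hn0
    gcongr

/-! ### From windows of fixed length to determinism -/

/-- A word of length `H` starting at or after `N` is covered by `H / M + 1` blocks from `W`, and
fewer than `N + 1` words start earlier. As `M` and `N` are fixed while `H` grows, the rate is
governed by `ε`. -/
lemma isDeterministic_of_forall_exists {A : Type*} (b : ℕ → A)
    (h : ∀ ε : ℝ, 0 < ε → ∃ M : ℕ, 1 ≤ M ∧ ∃ N : ℕ, ∃ W : Set (Fin M → A), W.Finite ∧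
      (W.ncard : ℝ) ≤ Real.exp (ε * M) ∧ ∀ n ≥ N, (fun l : Fin M => b (n + l)) ∈ W) :
    IsDeterministic b := by
  have key : ∀ ε : ℝ, 0 < ε → ∃ M N : ℕ, ∀ H : ℕ, (subwords b H).Finite ∧
      ((subwords b H).ncard : ℝ) ≤ N + Real.exp (ε * (H + M)) := by
    intro ε hε
    obtain ⟨M, hM, N, W, hWf, hW, hb⟩ := h ε hε
    refine ⟨M, N, fun H => ?_⟩
    let V₁ : Set (Fin H → A) := (fun (n : ℕ) (l : Fin H) => b (n + l)) '' Set.Iio N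
    let V₂ : Set (Fin H → A) := {w | ∃ n ≥ N, w = fun l : Fin H => b (n + l)}
    have hsub : subwords b H ⊆ V₁ ∪ V₂ := by
      rintro w ⟨n, rfl⟩
      rcases lt_or_ge n N with hn | hn
      · exact Or.inl ⟨n, hn, rfl⟩
      · exact Or.inr ⟨n, hn, rfl⟩
    have h1 : V₁.Finite := (Set.finite_Iio N).image _
    have h1' : V₁.ncard ≤ N := by
      refine (Set.ncard_image_le (Set.finite_Iio N)).trans ?_
      rw [← Finset.coe_Iio, Set.ncard_coe_finset, Nat.card_Iio]
    have h2 : V₂.Finite ∧ V₂.ncard ≤ Nat.card Unit * W.ncard ^ (H / M + 1) := by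
      refine ncard_le_of_assembled hWf
        (fun _ l => ⟨l / M, Nat.lt_succ_of_le (Nat.div_le_div_right l.2.le)⟩)
        (fun _ l => ⟨l % M, Nat.mod_lt _ hM⟩) ?_
      rintro w ⟨n, hn, rfl⟩
      refine ⟨(), fun i m => b (n + M * i + m), fun i => hb _ (by omega), fun l => ?_⟩
      simp only [add_assoc, Nat.div_add_mod]
    have hfin := h1.union h2.1
    refine ⟨hfin.subset hsub, ?_⟩
    have h3 : (subwords b H).ncard ≤ N + W.ncard ^ (H / M + 1) := by
      refine (Set.ncard_le_ncard hsub hfin).trans ((Set.ncard_union_le _ _).trans ?_)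
      have := h2.2
      rw [Nat.card_unique, one_mul] at this
      exact add_le_add h1' this
    have h4 := natCast_pow_le_exp (T := H / M + 1) hW
    have h5 : ((subwords b H).ncard : ℝ) ≤ N + (W.ncard : ℝ) ^ (H / M + 1) := by exact_mod_cast h3
    refine h5.trans (add_le_add le_rfl (h4.trans (Real.exp_le_exp.2 ?_)))
    refine mul_le_mul_of_nonneg_left ?_ hε.le
    have : M * (H / M + 1) ≤ H + M := by
      rw [mul_add, mul_one]
      exact add_le_add (Nat.mul_div_le H M) le_rfl
    exact_mod_cast this
  obtain ⟨_, _, hf⟩ := key 1 one_pos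
  refine ⟨fun H => (hf H).1, ?_⟩
  have hlog : ∀ H, 0 ≤ Real.log ((subwords b H).ncard : ℝ) := fun H => Real.log_natCast_nonneg _
  rw [Metric.tendsto_atTop]
  intro ε hε
  obtain ⟨M, N, hk⟩ := key (ε / 4) (by positivity)
  -- From `H₀` on, the overhead from `N` and `M` is at most `ε / 4 * H`, for a total exponent of `ε
  -- / 2 * H`.
  obtain ⟨H₀, hH₀⟩ := exists_nat_ge ((Real.log (N + 1) + ε / 4 * M) / (ε / 4))
  refine ⟨H₀ + 1, fun H hH => ?_⟩
  have hHpos : (0 : ℝ) < H := by exact_mod_cast (show 0 < H by omega)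
  rw [dist_zero_right, Real.norm_of_nonneg (mul_nonneg (by positivity) (hlog H)), one_div,
    inv_mul_lt_iff₀ hHpos]
  have hne : 0 < (subwords b H).ncard := (Set.ncard_pos (hf H).1).2 ⟨_, 0, rfl⟩
  have h1 : ((subwords b H).ncard : ℝ) ≤ Real.exp (ε / 2 * H) := by
    refine (hk H).2.trans ?_
    have h2 : (1 : ℝ) ≤ Real.exp (ε / 4 * (H + M)) := Real.one_le_exp (by positivity)
    have h3 : (H₀ : ℝ) ≤ H := by exact_mod_cast (show H₀ ≤ H by omega)
    rw [div_le_iff₀ (by positivity)] at hH₀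
    calc (N : ℝ) + Real.exp (ε / 4 * (H + M))
        ≤ (N + 1) * Real.exp (ε / 4 * (H + M)) := by
          nlinarith [(Nat.cast_nonneg N : (0 : ℝ) ≤ N)]
      _ = Real.exp (Real.log (N + 1) + ε / 4 * (H + M)) := by
          rw [Real.exp_add, Real.exp_log (by positivity)]
      _ ≤ Real.exp (ε / 2 * H) := by
          refine Real.exp_le_exp.2 ?_
          nlinarith
  have h2 := (Real.log_le_iff_le_exp (by exact_mod_cast hne)).2 h1
  nlinarith

/-- Along windows far from the origin, `n ^ c` is close to a real polynomial. By van der Waerden's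
theorem the window splits into long progressions on which this polynomial is close to an integer
polynomial plus a constant, so the words along `⌊n ^ c⌋` are assembled from words along integer
polynomials. The argument applies to every sequence that is uniformly deterministic along
polynomials, so the automaton generating `a` plays no role in it. -/
theorem mainTheorem7 {A : Type*} (k : ℕ) (hk : 2 ≤ k) (a : ℕ → A)
    (ha : IsSynchronizingAutomatic k hk a) (d : ℕ) (hd : 1 ≤ d)
    (hdet : IsUniformlyDeterministic a d) (c : ℝ) (hc : c ∈ Set.Ioo (0 : ℝ) ((d : ℝ) + 1)) :
    IsDeterministic (fun n : ℕ => a ⌊(n : ℝ) ^ c⌋₊) := by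
  have hc0 : 0 ≤ c := hc.1.le
  have hD : ⌊c⌋₊ ≤ d := by
    rw [← Nat.lt_succ_iff, Nat.floor_lt hc0]
    push_cast
    exact hc.2
  refine isDeterministic_of_forall_exists _ fun ε hε => ?_
  obtain ⟨M, hM, δ, hδ, hfin, hcard⟩ := exists_floorWords_ncard_le a hD hdet ⌊c⌋₊ le_rfl ε hε
  obtain ⟨N, hN⟩ := eventually_atTop.1 ((eventually_nearPolynomial_rpow hc0 M hδ).and
    (eventually_ge_atTop 1))
  exact ⟨M, hM, N, _, hfin, hcard, fun n hn =>
    ⟨_, diffNonneg_rpow hc0 (hN n hn).2, (hN n hn).1, rfl⟩⟩
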